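/- Let $F$ be a field. For a topological group $G$, let $\mathrm{Rep}^{\mathrm{cts}}_F(G)$ be the tensor category of finite-dimensional $F$-vector spaces $V$ with an $F$-linear $G$-action $G\times V\to V$ that is continuous for the discrete topology on $V$, and let $\omega_G$ be its forgetful functor to $F$-vector spaces. The algebraic hull $G^{\mathrm{cts}}$ of $G$ over $F$ is the affine group scheme over $F$ associated with $(\mathrm{Rep}^{\mathrm{cts}}_F(G),\omega_G)$ by Tannakian duality, that is, the affine group scheme (unique up to isomorphism) representing the functor $R\mapsto \mathrm{Aut}^{\otimes}_R(R\otimes_F\omega_G)$ from commutative $F$-algebras to groups. Let $(\pi_i)_i$ be a cofiltered inverse system of finite groups (for example, one indexed by a directed set) with surjective transition maps, and let $\pi=\varprojlim_i\pi_i$ be its limit, as a profinite topological group. For a finite group $\Gamma$ let $\Gamma_F=\mathrm{Spec}(F^{\Gamma})$ be the associated constant group scheme over $F$, where $F^{\Gamma}$ is the Hopf algebra of $F$-valued functions on $\Gamma$ (the dual of the group algebra $F[\Gamma]$). Then the limit $\pi_F:=\varprojlim_i(\pi_i)_F$ exists in the category of group schemes over $F$, the algebraic hull $\pi^{\mathrm{cts}}$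 of $\pi$ over $F$ exists, and there is an isomorphism of group schemes over $F$ $$\pi^{\mathrm{cts}}\;\cong\;\pi_F=\varprojlim_i(\pi_i)_F .$$ -/

import Mathlib

open CategoryTheory CategoryTheory.Limits AlgebraicGeometry
open scoped TensorProduct MonObj

universe u v

/-! ### The tensor category of continuous representations -/

/-- A continuous `F`-linear representation of a topological group `G`: a finite dimensional
`F`-vector space `V` with an `F`-linear action of `G` such that the action map `G × V → V` is
continuous for the discrete topology on `V`. -/
structure ContRep (F : Type u) [Field F] (G : Type v) [Group G] [TopologicalSpace G] where
  /-- the underlying vector space -/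
  V : Type u
  [addCommGroup : AddCommGroup V]
  [module : Module F V]
  [finite : Module.Finite F V]
  /-- the action of `G` -/
  ρ : Representation F G V
  continuous_action : letI : TopologicalSpace V := ⊥
    Continuous fun p : G × V => ρ p.1 p.2

namespace ContRep

attribute [instance] ContRep.addCommGroup ContRep.module ContRep.finite

variable {F : Type u} [Field F] {G : Type v} [Group G] [TopologicalSpace G]

/-- Morphisms of continuous representations are the `G`-equivariant linear maps. -/
instance : Category (ContRep F G) where
  Hom V W := V.ρ.IntertwiningMap W.ρ
  id V := .id V.ρ
  comp f g := g.comp f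

/-- The action map is continuous for the discrete topology on `V` if and only if all orbit maps
are locally constant. -/
theorem continuous_action_iff {V : Type u} [AddCommGroup V] [Module F V]
    (ρ : Representation F G V) :
    (letI : TopologicalSpace V := ⊥; Continuous fun p : G × V => ρ p.1 p.2) ↔
      ∀ v : V, IsLocallyConstant fun g : G => ρ g v := by
  let _ : TopologicalSpace V := ⊥
  have : DiscreteTopology V := ⟨rfl⟩
  constructor
  · intro h v
    exact (IsLocallyConstant.iff_continuous _).2
      (h.comp (by fun_prop : Continuous fun g : G => (g, v)))
  · intro h
    exact continuous_prod_of_discrete_right.2 fun v => (h v).continuous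

/-- The tensor product of continuous representations, with the diagonal action. -/
@[reducible] noncomputable def tensor (V W : ContRep F G) : ContRep F G where
  V := V.V ⊗[F] W.V
  ρ := V.ρ.tprod W.ρ
  continuous_action := by
    refine (continuous_action_iff _).2 fun t => ?_
    induction t with
    | zero =>
      simp only [map_zero]
      exact IsLocallyConstant.const _
    | tmul v w =>
      exact ((continuous_action_iff V.ρ).1 V.continuous_action v).comp₂
        ((continuous_action_iff W.ρ).1 W.continuous_action w) fun x y => x ⊗ₜ[F] y
    | add x y hx hy => 
      simp only [map_add]
      exact hx.add hy

/-- The unit object: the field `F` with the trivial action. -/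
@[reducible] noncomputable def unit (F : Type u) [Field F] (G : Type v) [Group G] [TopologicalSpace G] :
    ContRep F G where
  V := F
  ρ := Representation.trivial F G F
  continuous_action := (continuous_action_iff _).2 fun t => IsLocallyConstant.const t

end ContRep

/-! ### Tensor automorphisms of the forgetful functor and the algebraic hull -/

/-- The group `Aut^⊗(ω)(R)` of `R`-linear tensor automorphisms of `V ↦ R ⊗ ω(V)`, where `ω` is the
forgetful functor on continuous representations of `G`: families of `R`-linear automorphisms
of the modules `R ⊗ V` that are natural in `V`, compatible with tensor products and the
identity on the unit object. The group law is composition. -/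
noncomputable def tensorAut (F : Type u) [Field F] (G : Type v) [Group G] [TopologicalSpace G]
    (R : Type u) [CommRing R] [Algebra F R] :
    Subgroup (∀ V : ContRep F G, (R ⊗[F] V.V) ≃ₗ[R] (R ⊗[F] V.V)) where
  carrier := {a |
    (∀ (V W : ContRep F G) (f : V ⟶ W) (t : R ⊗[F] V.V),
      (Representation.IntertwiningMap.toLinearMap f).baseChange R (a V t) =
        a W ((Representation.IntertwiningMap.toLinearMap f).baseChange R t)) ∧
    (∀ (V W : ContRep F G) (t : R ⊗[F] (V.V ⊗[F] W.V)),
      TensorProduct.AlgebraTensorModule.distribBaseChange F R V.V W.V (a (V.tensor W) t) =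
        TensorProduct.map (a V).toLinearMap (a W).toLinearMap
          (TensorProduct.AlgebraTensorModule.distribBaseChange F R V.V W.V t)) ∧
    ∀ t : R ⊗[F] F, a (ContRep.unit F G) t = t}
  mul_mem' := by
    rintro a b ⟨ha, ha', ha''⟩ ⟨hb, hb', hb''⟩
    refine ⟨fun V W f t => ?_, fun V W t => ?_, fun t => ?_⟩
    · exact (ha V W f (b V t)).trans (congrArg (a W) (hb V W f t))
    · refine (ha' V W (b (V.tensor W) t)).trans ?_
      rw [hb' V W t, ← LinearMap.comp_apply, ← TensorProduct.map_comp]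
      rfl
    · exact (congrArg (a _) (hb'' t)).trans (ha'' t)
  one_mem' := by
    refine ⟨fun V W f t => rfl, fun V W t => ?_, fun t => rfl⟩
    exact (LinearMap.congr_fun TensorProduct.map_id _).symm
  inv_mem' := by
    rintro a ⟨ha, ha', ha''⟩
    refine ⟨fun V W f t => ?_, fun V W t => ?_, fun t => ?_⟩
    · apply (a W).injective
      change a W (_ : R ⊗[F] W.V) = a W ((a W).symm _)
      rw [LinearEquiv.apply_symm_apply, ← ha]
      exact congrArg _ ((a V).apply_symm_apply t)
    · obtain ⟨s, rfl⟩ := (a (V.tensor W)).surjective t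
      change _ = TensorProduct.map _ _
        (TensorProduct.AlgebraTensorModule.distribBaseChange F R V.V W.V (a (V.tensor W) s))
      rw [ha', ← LinearMap.comp_apply, ← TensorProduct.map_comp]
      have h1 : ∀ U : ContRep F G, ((a⁻¹) U).toLinearMap ∘ₗ (a U).toLinearMap = LinearMap.id :=
        fun U => LinearMap.ext fun x => (a U).symm_apply_apply x
      rw [h1, h1, TensorProduct.map_id]
      exact congrArg _ ((a (V.tensor W)).symm_apply_apply s)
    · exact (congrArg (a (ContRep.unit F G)).symm (ha'' t)).symm.trans
        ((a (ContRep.unit F G)).symm_apply_apply t)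

/-- The `F`-scheme `Spec R` for an `F`-algebra `R`. -/
noncomputable abbrev specOver (F : Type u) [Field F] (R : Type u) [CommRing R] [Algebra F R] :
    Over (Spec (CommRingCat.of F)) :=
  (algSpec (CommRingCat.of F)).obj (.op (CommAlgCat.of F R))

/-- The morphism of `F`-schemes `Spec S ⟶ Spec R` given by an `F`-algebra map `R → S`. -/
noncomputable abbrev specOverMap {F : Type u} [Field F] {R S : Type u} [CommRing R] [Algebra F R]
    [CommRing S] [Algebra F S] (φ : R →ₐ[F] S) : specOver F S ⟶ specOver F R :=
  (algSpec (CommRingCat.of F)).map (CommAlgCat.ofHom φ).op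

/-- `H` is an algebraic hull of `G` over `F`, the affine group scheme attached by Tannakian duality
to the category of continuous `F`-linear representations of `G` with its forgetful functor `ω`: it is affine, and it represents
the functor `Aut^⊗(ω)` on `F`-algebras, that is, there are group isomorphisms
`H(R) ≃ Aut^⊗(ω)(R)` for all `F`-algebras `R` which are natural in `R`. The displayed equation is
the naturality: the automorphism attached to the image of `x` in `H(S)` restricts along
`R ⊗ V → S ⊗ V` to the one attached to `x`, i.e. it is its base change to `S`. -/
def IsAlgebraicHull (F : Type u) [Field F] (G : Type v) [Group G] [TopologicalSpace G]
    (H : Grp (Over (Spec (CommRingCat.of F)))) : Prop :=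
  IsAffine H.X.left ∧
  ∃ e : ∀ (R : Type u) [CommRing R] [Algebra F R], (specOver F R ⟶ H.X) ≃* tensorAut F G R,
    ∀ (R S : Type u) [CommRing R] [Algebra F R] [CommRing S] [Algebra F S] (φ : R →ₐ[F] S)
      (x : specOver F R ⟶ H.X) (V : ContRep F G) (t : R ⊗[F] V.V),
      (e S (specOverMap φ ≫ x)).1 V (φ.toLinearMap.rTensor V.V t) =
        φ.toLinearMap.rTensor V.V ((e R x).1 V t)

/-! ### Constant group schemes -/

/-- The `F`-algebra `F^G` of functions on a finite group `G`. It carries the Hopf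
algebra structure dual to the group algebra `F[G]`. -/
def FunctionHopf (F : Type u) (G : Type v) : Type (max u v) := G → F

namespace FunctionHopf

variable (F : Type u) [Field F] (G : Type v)

instance : CommRing (FunctionHopf F G) := inferInstanceAs (CommRing (G → F))
instance : Algebra F (FunctionHopf F G) := inferInstanceAs (Algebra F (G → F))

variable {F G}

open Classical in
/-- The indicator function of `g`. -/
noncomputable def delta (F : Type u) [Field F] {G : Type v} (g : G) : FunctionHopf F G :=
  fun h => if h = g then 1 else 0

/-- Pullback of functions along a map, as an algebra homomorphism. -/
def pullback (F : Type u) [Field F] {G H : Type v} (φ : G → H) :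
    FunctionHopf F H →ₐ[F] FunctionHopf F G where
  toFun f := fun g => f (φ g)
  map_one' := rfl
  map_mul' _ _ := rfl
  map_zero' := rfl
  map_add' _ _ := rfl
  commutes' _ := rfl

/-- The counit: evaluation at `1`. -/
def counitHom (F : Type u) [Field F] (G : Type v) [Group G] : FunctionHopf F G →ₐ[F] F where
  toFun f := f 1
  map_one' := rfl
  map_mul' _ _ := rfl
  map_zero' := rfl
  map_add' _ _ := rfl
  commutes' _ := rfl

theorem mul_delta (g : G) (f : FunctionHopf F G) : f * delta F g = f g • delta F g := by
  classical
  funext h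
  change f h * (if h = g then (1 : F) else 0) = f g * (if h = g then 1 else 0)
  split_ifs with hh <;> simp [hh]

theorem delta_mul_delta_self (g : G) : delta F g * delta F g = delta F g := by
  rw [mul_delta]
  simp [delta]

theorem delta_mul_delta_of_ne {g h : G} (hgh : g ≠ h) : delta F g * delta F h = 0 := by
  rw [mul_delta]
  simp [delta, hgh.symm]

theorem pullback_delta_equiv {H : Type v} (φ : G ≃ H) (h : H) :
    pullback F φ (delta F h) = delta F (φ.symm h) := by
  classical
  funext g
  change (if φ g = h then (1 : F) else 0) = if g = φ.symm h then 1 else 0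
  simp only [Equiv.eq_symm_apply]

variable [Finite G]

attribute [local instance] Fintype.ofFinite

theorem sum_smul_delta (f : FunctionHopf F G) : ∑ g, f g • delta F g = f := by
  classical
  funext h
  refine (Finset.sum_apply (M := fun _ : G => F) h _ _).trans ?_
  refine (Finset.sum_eq_single h (fun g _ hg => ?_) (by simp)).trans ?_
  · change f g * (if h = g then (1 : F) else 0) = 0
    simp [hg.symm]
  · change f h * (if h = h then (1 : F) else 0) = f h
    simp

theorem sum_delta : ∑ g : G, delta F g = 1 := by
  rw [← sum_smul_delta (1 : FunctionHopf F G)]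
  exact Finset.sum_congr rfl fun g _ => (one_smul F _).symm

variable [Group G]

/-- The comultiplication, that is `f ↦ ((g, h) ↦ f (g * h))` under the identification
of `F^G ⊗ F^G` with `F^(G × G)`. -/
noncomputable def comulHom (F : Type u) [Field F] (G : Type v) [Group G] [Finite G] :
    FunctionHopf F G →ₐ[F] FunctionHopf F G ⊗[F] FunctionHopf F G :=
  AlgHom.ofLinearMap
    (∑ g : G, TensorProduct.mk F _ _ (delta F g) ∘ₗ (pullback F (g * ·)).toLinearMap)
    (by
      simp only [LinearMap.sum_apply, LinearMap.comp_apply, AlgHom.toLinearMap_apply, map_one,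
        TensorProduct.mk_apply]
      rw [← TensorProduct.sum_tmul, sum_delta]
      rfl)
    (by
      intro x y
      simp only [LinearMap.sum_apply, LinearMap.comp_apply, AlgHom.toLinearMap_apply, map_mul,
        TensorProduct.mk_apply]
      rw [Finset.sum_mul_sum]
      refine Finset.sum_congr rfl fun g _ => ?_
      rw [Finset.sum_eq_single g]
      · rw [Algebra.TensorProduct.tmul_mul_tmul, delta_mul_delta_self]
      · intro h _ hh
        rw [Algebra.TensorProduct.tmul_mul_tmul, delta_mul_delta_of_ne hh.symm,
          TensorProduct.zero_tmul]
      · simp)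

theorem comulHom_apply (f : FunctionHopf F G) :
    comulHom F G f = ∑ g : G, delta F g ⊗ₜ[F] pullback F (g * ·) f := by
  simp [comulHom]

theorem sum_apply_one_smul (f : FunctionHopf F G) :
    ∑ g : G, counitHom F G (delta F g) • pullback F (g * ·) f = f := by
  classical
  refine (Finset.sum_eq_single 1 (fun g _ hg => ?_) (by simp)).trans ?_
  · change (if 1 = g then (1 : F) else 0) • _ = _
    simp [hg.symm]
  · change (if (1 : G) = 1 then (1 : F) else 0) • _ = _
    rw [if_pos rfl, one_smul]
    funext h
    exact congrArg f (one_mul h)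

noncomputable instance : Bialgebra F (FunctionHopf F G) :=
  Bialgebra.ofAlgHom (comulHom F G) (counitHom F G)
    (by
      refine AlgHom.ext fun f => ?_
      have h (a g : G) : pullback F (a * ·) (delta F g) = delta F (a⁻¹ * g) :=
        pullback_delta_equiv (Equiv.mulLeft a) g
      have hf (a b : G) : pullback F (b * ·) (pullback F (a * ·) f) = pullback F (a * b * ·) f :=
        funext fun c => congrArg f (mul_assoc a b c).symm
      simp only [AlgHom.comp_apply, comulHom_apply, map_sum, Algebra.TensorProduct.map_tmul,
        TensorProduct.sum_tmul, TensorProduct.tmul_sum, AlgHom.id_apply, h, hf]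
      rw [Finset.sum_comm]
      refine Finset.sum_congr rfl fun a _ => ?_
      refine Fintype.sum_equiv (Equiv.mulLeft a⁻¹) _ _ fun g => ?_
      simp)
    (by
      refine AlgHom.ext fun f => ?_
      apply (Algebra.TensorProduct.lid F (FunctionHopf F G)).injective
      simp only [AlgHom.comp_apply, comulHom_apply, map_sum, Algebra.TensorProduct.map_tmul,
        AlgHom.id_apply, Algebra.TensorProduct.lid_tmul, sum_apply_one_smul]
      exact ((Algebra.TensorProduct.lid F (FunctionHopf F G)).apply_symm_apply f).symm)
    (by
      refine AlgHom.ext fun f => ?_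
      apply (Algebra.TensorProduct.rid F F (FunctionHopf F G)).injective
      have h (g : G) : counitHom F G (pullback F (g * ·) f) = f g := congrArg f (mul_one g)
      simp only [AlgHom.comp_apply, comulHom_apply, map_sum, Algebra.TensorProduct.map_tmul,
        AlgHom.id_apply, Algebra.TensorProduct.rid_tmul, h, sum_smul_delta]
      exact ((Algebra.TensorProduct.rid F F (FunctionHopf F G)).apply_symm_apply f).symm)

/-- The antipode is `f ↦ (g ↦ f g⁻¹)`. -/
noncomputable instance : HopfAlgebra F (FunctionHopf F G) :=
  HopfAlgebra.ofAlgHom (pullback F fun g : G => g⁻¹)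
    (by
      refine AlgHom.ext fun f => ?_
      have h (g : G) : pullback F (fun g : G => g⁻¹) (delta F g) = delta F g⁻¹ :=
        pullback_delta_equiv (Equiv.inv G) g
      have hf (g : G) : pullback F (g * ·) f g⁻¹ = f 1 := congrArg f (mul_inv_cancel g)
      change Algebra.TensorProduct.lift _ _ (fun _ _ => Commute.all _ _) (comulHom F G f) = algebraMap F _ (f 1)
      simp only [comulHom_apply, map_sum, Algebra.TensorProduct.lift_tmul, AlgHom.id_apply, h,
        mul_comm (delta F _), mul_delta, hf]
      rw [← Finset.smul_sum, Algebra.algebraMap_eq_smul_one, ← sum_delta]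
      congr 1
      exact Fintype.sum_equiv (Equiv.inv G) _ _ fun g => rfl)
    (by
      refine AlgHom.ext fun f => ?_
      have hf (g : G) : pullback F (fun g : G => g⁻¹) (pullback F (g * ·) f) g = f 1 :=
        congrArg f (mul_inv_cancel g)
      change Algebra.TensorProduct.lift _ _ (fun _ _ => Commute.all _ _) (comulHom F G f) = algebraMap F _ (f 1)
      simp only [comulHom_apply, map_sum, Algebra.TensorProduct.lift_tmul, AlgHom.id_apply,
        mul_comm (delta F _), mul_delta, hf]
      rw [← Finset.smul_sum, Algebra.algebraMap_eq_smul_one, ← sum_delta])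

/-- Pullback of functions along a group homomorphism is a morphism of Hopf algebras. -/
noncomputable def pullbackHom (F : Type u) [Field F] {G H : Type v} [Group G] [Finite G] [Group H]
    [Finite H] (φ : G →* H) : FunctionHopf F H →ₐc[F] FunctionHopf F G :=
  BialgHom.ofAlgHom (pullback F φ)
    (by
      refine AlgHom.ext fun f => ?_
      exact congrArg f (map_one φ))
    (by
      classical
      refine AlgHom.ext fun f => ?_
      change Algebra.TensorProduct.map (pullback F φ) (pullback F φ) (comulHom F H f) =
        comulHom F G (pullback F φ f)
      have h (x : H) : pullback F φ (delta F x) = ∑ g : G with φ g = x, delta F g := by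
        rw [← sum_smul_delta (pullback F φ (delta F x)), Finset.sum_filter]
        refine Finset.sum_congr rfl fun g _ => ?_
        change (if φ g = x then (1 : F) else 0) • _ = _
        split_ifs <;> simp
      simp only [comulHom_apply, map_sum, Algebra.TensorProduct.map_tmul, h,
        TensorProduct.sum_tmul]
      rw [← Finset.sum_fiberwise Finset.univ φ]
      refine Finset.sum_congr rfl fun x _ => Finset.sum_congr rfl fun g hg => ?_
      obtain rfl : φ g = x := (Finset.mem_filter.1 hg).2
      congr 1
      funext k
      exact congrArg f (map_mul φ g k).symm)

end FunctionHopf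

/-- The contravariant functor `G ↦ F^G` from finite groups to commutative Hopf algebras. -/
noncomputable def functionHopfFunctor (F : Type u) [Field F] :
    FiniteGrp.{u} ⥤ (CommHopfAlgCat.{u} F)ᵒᵖ where
  obj G := .op (CommHopfAlgCat.of F (FunctionHopf F G))
  map φ := (CommHopfAlgCat.ofHom
    (FunctionHopf.pullbackHom F (ConcreteCategory.hom (C := FiniteGrp) φ))).op
  map_id _ := rfl
  map_comp _ _ := rfl

/-- The constant group scheme `G_F = Spec F^G` over `F` associated with a finite group `G`, as a
functor of `G`. -/
noncomputable def constantGroupScheme (F : Type u) [Field F] :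
    FiniteGrp.{u} ⥤ Grp (Over (Spec (CommRingCat.of F))) :=
  functionHopfFunctor F ⋙ hopfSpec (CommRingCat.of F)

/-!
# The algebraic hull of a profinite group

Let `π = lim π_j` with surjective transition maps between the finite groups `π_j`, and let `A` be
the algebra of locally constant functions `π → F`. The projections `π → π_j` are surjective and
every locally constant function factors through one of them, so `A` is the colimit of the algebras
`F^{π_j}` (`FiniteQuotientSystem.desc`). Hence `Spec A` is the limit of the underlying schemes of
the constant group schemes, and it inherits the structure of a limit of group schemes from its
components (`CategoryTheory.Grp.limitCone`, `FiniteQuotientSystem.limitGroupScheme`).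

An `R`-point of `Spec A`, that is a homomorphism `x : A → R`, acts on `R ⊗ V` for every continuous
representation `V`: apply `x` to the matrix coefficients `g ↦ ℓ (g v)`, which are locally constant
(`ContRep.pointAction`). Since matrix coefficients of tensor products are products of matrix
coefficients, these actions form a tensor automorphism of the forgetful functor; since `V` factors
through some `π_j`, where products of points are given by the comultiplication of `F^{π_j}`, points
act as a group (`FiniteQuotientSystem.pointAction_mul`).

Conversely, a tensor automorphism `a` gives homomorphisms `F^{π_j} → R`, by
`h ↦ (a (1 ⊗ h))(1)` in the regular representation. These are multiplicative because `a` commutes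
with the multiplication `F^{π_j} ⊗ F^{π_j} → F^{π_j}` of the regular representation, and they are
compatible in `j`, so they define a point of `Spec A`. This point acts as `a` because matrix
coefficients are equivariant maps from `V` to regular representations
(`FiniteQuotientSystem.pointAction_point`). So `Spec A` is an algebraic hull of `π`, and algebraic
hulls are unique by Yoneda's lemma on affine schemes (`IsAlgebraicHull.nonempty_iso`).
-/

/-! ### Limits of group objects -/

namespace CategoryTheory.Grp

open CartesianMonoidalCategory

variable {J : Type*} [Category J] {C : Type*} [Category C] [CartesianMonoidalCategory C]
  (E : J ⥤ Grp C) (c : Cone (E ⋙ Grp.forget C)) (hc : IsLimit c)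

/-- The group object structure on a limit of the objects underlying a diagram of group objects:
multiplication and inversion are the limits of those of the diagram. Only the limit of this one
diagram is assumed to exist. -/
def limitObj : Grp C where
  X := c.pt
  grp :=
    let π (j : J) : c.pt ⟶ (E.obj j).X := c.π.app j
    let _ : MonObj c.pt := (Mon.limit (E ⋙ Grp.forget₂Mon C) c hc).mon
    have (j : J) : IsMonHom (π j) :=
      ((Mon.limitCone (E ⋙ Grp.forget₂Mon C) c hc).π.app j).isMonHom_hom
    let s : Cone (E ⋙ Grp.forget C) :=
      { pt := c.pt
        π :=
          { app := fun j => ((π j)⁻¹ : c.pt ⟶ (E.obj j).X)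
            naturality := fun i j f => by
              have h : π i ≫ (E.map f).hom.hom = π j := c.w f
              change 𝟙 _ ≫ (π j)⁻¹ = (π i)⁻¹ ≫ (E.map f).hom.hom
              rw [GrpObj.inv_comp, h, Category.id_comp] } }
    have hs (j : J) : hc.lift s ≫ π j = (π j)⁻¹ := hc.fac s j
    { inv := hc.lift s
      left_inv := hc.hom_ext fun j => by
        change (hc.lift s * 𝟙 c.pt) ≫ π j = (1 : c.pt ⟶ c.pt) ≫ π j
        rw [MonObj.mul_comp, MonObj.one_comp, hs, Category.id_comp, inv_mul_cancel]
      right_inv := hc.hom_ext fun j => by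
        change (𝟙 c.pt * hc.lift s) ≫ π j = (1 : c.pt ⟶ c.pt) ≫ π j
        rw [MonObj.mul_comp, MonObj.one_comp, hs, Category.id_comp, mul_inv_cancel] }

/-- A limit cone of the underlying objects, as a cone of group objects. -/
def limitCone : Cone E where
  pt := limitObj E c hc
  π :=
    { app := fun j => Grp.homMk' ((Mon.limitCone (E ⋙ Grp.forget₂Mon C) c hc).π.app j)
      naturality := fun i j f => by
        ext
        exact c.π.naturality f }

/-- The cone of group objects over a limit cone of underlying objects is a limit cone. -/
def isLimitLimitCone : IsLimit (limitCone E c hc) where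
  lift s := Grp.homMk' ((Mon.limitConeIsLimit (E ⋙ Grp.forget₂Mon C) c hc).lift
    ((Grp.forget₂Mon C).mapCone s))
  fac s j := by
    ext
    exact hc.fac ((Grp.forget C).mapCone s) j
  uniq s m w := by
    ext
    exact hc.uniq ((Grp.forget C).mapCone s) m.hom.hom fun j => congr($(w j).hom.hom)

end CategoryTheory.Grp

/-! ### Extension of linear forms to base changes -/

namespace LinearMap

variable {F : Type*} [CommRing F] {V : Type*} [AddCommGroup V] [Module F V]

/-- The `R`-linear form on `R ⊗ V` induced by a linear form on `V`. -/
noncomputable def formBaseChange (R : Type*) [CommRing R] [Algebra F R] (ℓ : V →ₗ[F] F) :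
    R ⊗[F] V →ₗ[R] R :=
  (Algebra.linearMap F R ∘ₗ ℓ).liftBaseChange R

variable {R : Type*} [CommRing R] [Algebra F R]

@[simp]
theorem formBaseChange_tmul (ℓ : V →ₗ[F] F) (r : R) (v : V) :
    ℓ.formBaseChange R (r ⊗ₜ v) = r * algebraMap F R (ℓ v) := by
  simp [formBaseChange]

theorem formBaseChange_baseChange {W : Type*} [AddCommGroup W] [Module F W] (ℓ : W →ₗ[F] F)
    (f : V →ₗ[F] W) (t : R ⊗[F] V) :
    ℓ.formBaseChange R (f.baseChange R t) = (ℓ ∘ₗ f).formBaseChange R t := by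
  induction t with
  | zero => simp
  | tmul r v => simp
  | add x y hx hy => rw [map_add, map_add, map_add, hx, hy]

theorem sum_formBaseChange_coord {κ : Type*} [Fintype κ] (b : Module.Basis κ F V) (t : R ⊗[F] V) :
    ∑ k, (b.coord k).formBaseChange R t ⊗ₜ[F] b k = t := by
  induction t with
  | zero => simp
  | tmul r v =>
    simp only [formBaseChange_tmul, Module.Basis.coord_apply, ← Algebra.commutes,
      ← Algebra.smul_def, TensorProduct.smul_tmul]
    rw [← TensorProduct.tmul_sum, b.sum_repr]
  | add x y hx hy =>
    simp only [map_add, TensorProduct.add_tmul, Finset.sum_add_distrib, hx, hy]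

/-- For finite free `V`, elements of `R ⊗ V` are separated by the linear forms on `V`. -/
theorem formBaseChange_ext [Module.Free F V] [Module.Finite F V] {s t : R ⊗[F] V}
    (h : ∀ ℓ : V →ₗ[F] F, ℓ.formBaseChange R s = ℓ.formBaseChange R t) : s = t := by
  rw [← sum_formBaseChange_coord (Module.Free.chooseBasis F V) s]
  simp only [h, sum_formBaseChange_coord]

end LinearMap

/-! ### The action of points of the algebra of locally constant functions -/

namespace ContRep

variable {F : Type u} [Field F] {G : Type v} [Group G] [TopologicalSpace G]

/-- The matrix coefficient `g ↦ ℓ (g v)` of a continuous representation, as a locally constant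
function on the group. -/
def matrixCoeff (V : ContRep F G) (ℓ : V.V →ₗ[F] F) : V.V →ₗ[F] LocallyConstant G F where
  toFun v := ⟨fun g => ℓ (V.ρ g v),
    ((continuous_action_iff V.ρ).1 V.continuous_action v).comp ℓ⟩
  map_add' v w := by ext; simp
  map_smul' a v := by ext; simp

@[simp]
theorem matrixCoeff_apply (V : ContRep F G) (ℓ : V.V →ₗ[F] F) (v : V.V) (g : G) :
    V.matrixCoeff ℓ v g = ℓ (V.ρ g v) := rfl

variable {R : Type u} [CommRing R] [Algebra F R]

/-- The endomorphism of `R ⊗ V` attached to an `R`-point `x` of the algebra of locally constant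
functions: in a basis of `V`, it is the matrix obtained by applying `x` to the matrix
coefficients of `V`. -/
noncomputable def pointAction (V : ContRep F G) (x : LocallyConstant G F →ₐ[F] R) :
    R ⊗[F] V.V →ₗ[R] R ⊗[F] V.V :=
  LinearMap.liftBaseChange R (∑ k, (TensorProduct.mk F R V.V).flip (Module.finBasis F V.V k) ∘ₗ
    x.toLinearMap ∘ₗ V.matrixCoeff ((Module.finBasis F V.V).coord k))

/-- A characterization of `pointAction` that does not involve a basis. -/
@[simp]
theorem formBaseChange_pointAction_tmul (V : ContRep F G) (x : LocallyConstant G F →ₐ[F] R)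
    (ℓ : V.V →ₗ[F] F) (r : R) (v : V.V) :
    ℓ.formBaseChange R (V.pointAction x (r ⊗ₜ v)) = r * x (V.matrixCoeff ℓ v) := by
  have h : V.matrixCoeff ℓ v = ∑ k, ℓ (Module.finBasis F V.V k) •
      V.matrixCoeff ((Module.finBasis F V.V).coord k) v := by
    ext g
    conv_lhs => rw [matrixCoeff_apply, ← (Module.finBasis F V.V).sum_repr (V.ρ g v)]
    rw [map_sum, ← LocallyConstant.coeFnAddMonoidHom_apply, map_sum, Finset.sum_apply]
    refine Finset.sum_congr rfl fun k _ => ?_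
    simp [mul_comm]
  rw [h]
  simp [pointAction, Finset.mul_sum, Algebra.smul_def, mul_comm]

theorem pointAction_tmul (V : ContRep F G) (x : LocallyConstant G F →ₐ[F] R)
    {κ : Type*} [Fintype κ] (b : Module.Basis κ F V.V) (r : R) (v : V.V) :
    V.pointAction x (r ⊗ₜ v) = ∑ k, (r * x (V.matrixCoeff (b.coord k) v)) ⊗ₜ[F] b k := by
  rw [← LinearMap.sum_formBaseChange_coord b (V.pointAction x (r ⊗ₜ v))]
  simp only [formBaseChange_pointAction_tmul]

theorem pointAction_natural {V W : ContRep F G} (f : V ⟶ W) (x : LocallyConstant G F →ₐ[F] R)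
    (t : R ⊗[F] V.V) :
    (Representation.IntertwiningMap.toLinearMap f).baseChange R (V.pointAction x t) =
      W.pointAction x ((Representation.IntertwiningMap.toLinearMap f).baseChange R t) := by
  induction t with
  | zero => simp
  | add s t hs ht => simp only [map_add, hs, ht]
  | tmul r v =>
    refine LinearMap.formBaseChange_ext fun ℓ => ?_
    rw [LinearMap.formBaseChange_baseChange, LinearMap.baseChange_tmul]
    simp only [formBaseChange_pointAction_tmul]
    congr 2
    ext g
    exact congrArg ℓ (Representation.IntertwiningMap.isIntertwining V.ρ W.ρ f g v)

/-- This is where the multiplicativity of points is used: the matrix coefficients of a tensor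
product are products of matrix coefficients. -/
theorem pointAction_tensor (V W : ContRep F G) (x : LocallyConstant G F →ₐ[F] R)
    (t : R ⊗[F] (V.V ⊗[F] W.V)) :
    TensorProduct.AlgebraTensorModule.distribBaseChange F R V.V W.V
        ((V.tensor W).pointAction x t) =
      TensorProduct.map (V.pointAction x) (W.pointAction x)
        (TensorProduct.AlgebraTensorModule.distribBaseChange F R V.V W.V t) := by
  induction t with
  | zero => simp
  | add s t hs ht => simp only [map_add, hs, ht]
  | tmul r t =>
  induction t with
  | zero => simp
  | add s t hs ht => simp only [TensorProduct.tmul_add, map_add, hs, ht]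
  | tmul v w =>
    let b := Module.finBasis F V.V
    let b' := Module.finBasis F W.V
    have h k l : (V.tensor W).matrixCoeff ((b.tensorProduct b').coord (k, l)) (v ⊗ₜ w) =
        V.matrixCoeff (b.coord k) v * W.matrixCoeff (b'.coord l) w := by
      ext g
      exact (Module.Basis.tensorProduct_repr_tmul_apply b b' _ _ k l).trans (mul_comm _ _)
    rw [pointAction_tmul _ x (b.tensorProduct b')]
    simp only [TensorProduct.AlgebraTensorModule.distribBaseChange_tmul, map_sum,
      TensorProduct.map_tmul, pointAction_tmul _ x b, pointAction_tmul _ x b', Fintype.sum_prod_type,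
      TensorProduct.sum_tmul, TensorProduct.tmul_sum, h, map_mul]
    rw [Finset.sum_comm]
    refine Finset.sum_congr rfl fun l _ => ?_
    refine Finset.sum_congr rfl fun k _ => ?_
    rw [Module.Basis.tensorProduct_apply,
      TensorProduct.AlgebraTensorModule.distribBaseChange_tmul]
    set p := x (V.matrixCoeff (b.coord k) v)
    set q := x (W.matrixCoeff (b'.coord l) w)
    have h1 : (1 * q) ⊗ₜ[F] b' l = q • (1 : R) ⊗ₜ[F] b' l := by
      rw [TensorProduct.smul_tmul', smul_eq_mul, mul_one, one_mul]
    have h2 : (r * (p * q)) ⊗ₜ[F] b k = q • (r * p) ⊗ₜ[F] b k := by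
      rw [TensorProduct.smul_tmul', smul_eq_mul]
      congr 1
      ring
    rw [h1, h2, TensorProduct.smul_tmul]

theorem pointAction_unit (x : LocallyConstant G F →ₐ[F] R) (t : R ⊗[F] F) :
    (ContRep.unit F G).pointAction x t = t := by
  induction t with
  | zero => simp
  | add s t hs ht => simp only [map_add, hs, ht]
  | tmul r t =>
    refine LinearMap.formBaseChange_ext fun ℓ => ?_
    rw [formBaseChange_pointAction_tmul, LinearMap.formBaseChange_tmul, ← x.commutes]
    rfl

theorem pointAction_comp {S : Type u} [CommRing S] [Algebra F S] (φ : R →ₐ[F] S) (V : ContRep F G)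
    (x : LocallyConstant G F →ₐ[F] R) (t : R ⊗[F] V.V) :
    V.pointAction (φ.comp x) (φ.toLinearMap.rTensor V.V t) =
      φ.toLinearMap.rTensor V.V (V.pointAction x t) := by
  induction t with
  | zero => simp
  | add s t hs ht => simp only [map_add, hs, ht]
  | tmul r t =>
    simp [pointAction_tmul _ _ (Module.finBasis F V.V)]

end ContRep

/-! ### Presentations of a profinite group by finite quotients -/

/-- A presentation of a topological group `G` as a limit of its finite quotients `D j`, in the form
used below: compatible locally constant surjections `G → D j` such that every locally constant
function on `G` comes from some `D j`. -/
structure FiniteQuotientSystem (G : Type u) [Group G] [TopologicalSpace G] {J : Type v}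
    [Category J] (D : J ⥤ FiniteGrp.{u}) where
  /-- the projections to the finite quotients -/
  proj (j : J) : G →* D.obj j
  map_proj {i j : J} (f : i ⟶ j) (g : G) :
    ConcreteCategory.hom (D.map f) (proj i g) = proj j g
  proj_surjective (j : J) : Function.Surjective (proj j)
  isLocallyConstant_proj (j : J) : IsLocallyConstant (proj j)
  exists_factor {α : Type u} (f : LocallyConstant G α) :
    ∃ (j : J) (f' : D.obj j → α), ∀ g, f' (proj j g) = f g

namespace FiniteQuotientSystem

variable {G : Type u} [Group G] [TopologicalSpace G] {J : Type v} [Category J]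
  {D : J ⥤ FiniteGrp.{u}} (q : FiniteQuotientSystem G D) (F : Type u) [Field F]
  {R : Type u} [CommRing R] [Algebra F R]

/-- Inflation of functions on a finite quotient to locally constant functions on the group. -/
def inflate (j : J) : FunctionHopf F (D.obj j) →ₐ[F] LocallyConstant G F where
  toFun h := ⟨fun g => h (q.proj j g), (q.isLocallyConstant_proj j).comp h⟩
  map_one' := rfl
  map_mul' _ _ := rfl
  map_zero' := rfl
  map_add' _ _ := rfl
  commutes' _ := rfl

variable {F}

theorem inflate_injective (j : J) : Function.Injective (q.inflate F j) := by
  intro h h' hh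
  funext a
  obtain ⟨g, rfl⟩ := q.proj_surjective j a
  exact congr($hh g)

theorem exists_inflate_eq (f : LocallyConstant G F) : ∃ j h, q.inflate F j h = f := by
  obtain ⟨j, h, hh⟩ := q.exists_factor f
  exact ⟨j, h, LocallyConstant.ext hh⟩

theorem inflate_pullback {i j : J} (f : i ⟶ j) (h : FunctionHopf F (D.obj j)) :
    q.inflate F i (FunctionHopf.pullback F (ConcreteCategory.hom (D.map f)) h) =
      q.inflate F j h :=
  LocallyConstant.ext fun g => congrArg h (q.map_proj f g)

theorem algHom_ext {x y : LocallyConstant G F →ₐ[F] R}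
    (h : ∀ j h, x (q.inflate F j h) = y (q.inflate F j h)) : x = y := by
  ext f
  obtain ⟨j, h', rfl⟩ := q.exists_inflate_eq f
  exact h j h'

section Desc

variable [IsCofiltered J]

/-- A compatible family of maps on the function algebras of the finite quotients depends only on
the inflated function. Surjectivity of the projections enters here, through the injectivity of
`inflate`. -/
theorem eq_of_inflate_eq {B : Type*} {x : ∀ j, FunctionHopf F (D.obj j) → B}
    (hx : ∀ (i j : J) (f : i ⟶ j) (h : FunctionHopf F (D.obj j)),
      x i (FunctionHopf.pullback F (ConcreteCategory.hom (D.map f)) h) = x j h)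
    {i j : J} {h : FunctionHopf F (D.obj i)} {h' : FunctionHopf F (D.obj j)}
    (hh : q.inflate F i h = q.inflate F j h') : x i h = x j h' := by
  rw [← hx _ _ (IsCofiltered.minToLeft i j), ← hx _ _ (IsCofiltered.minToRight i j)]
  congr 1
  apply q.inflate_injective
  rw [inflate_pullback, inflate_pullback, hh]

theorem exists_inflate_eq₂ (f f' : LocallyConstant G F) :
    ∃ j h h', q.inflate F j h = f ∧ q.inflate F j h' = f' := by
  obtain ⟨i, h, rfl⟩ := q.exists_inflate_eq f
  obtain ⟨j, h', rfl⟩ := q.exists_inflate_eq f'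
  exact ⟨_, _, _, q.inflate_pullback (IsCofiltered.minToLeft i j) h,
    q.inflate_pullback (IsCofiltered.minToRight i j) h'⟩

/-- The algebra of locally constant functions is the colimit of the function algebras of the
finite quotients: the homomorphism induced by a compatible family of homomorphisms. -/
noncomputable def desc (x : ∀ j, FunctionHopf F (D.obj j) →ₐ[F] R)
    (hx : ∀ (i j : J) (f : i ⟶ j) (h : FunctionHopf F (D.obj j)),
      x i (FunctionHopf.pullback F (ConcreteCategory.hom (D.map f)) h) = x j h) :
    LocallyConstant G F →ₐ[F] R :=
  let φ (f : LocallyConstant G F) : R :=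
    x (q.exists_inflate_eq f).choose (q.exists_inflate_eq f).choose_spec.choose
  have hφ (j : J) (h : FunctionHopf F (D.obj j)) : φ (q.inflate F j h) = x j h :=
    q.eq_of_inflate_eq (x := fun j h => x j h) hx
      (q.exists_inflate_eq (q.inflate F j h)).choose_spec.choose_spec
  have hmul (f f' : LocallyConstant G F) : φ (f * f') = φ f * φ f' := by
    obtain ⟨j, h, h', rfl, rfl⟩ := q.exists_inflate_eq₂ f f'
    rw [← map_mul, hφ, hφ, hφ, map_mul]
  have hadd (f f' : LocallyConstant G F) : φ (f + f') = φ f + φ f' := by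
    obtain ⟨j, h, h', rfl, rfl⟩ := q.exists_inflate_eq₂ f f'
    rw [← map_add, hφ, hφ, hφ, map_add]
  have halg (c : F) : φ (algebraMap F _ c) = algebraMap F R c := by
    obtain ⟨j⟩ := IsCofiltered.nonempty (C := J)
    rw [← (q.inflate F j).commutes, hφ, AlgHom.commutes]
  { toFun := φ
    map_one' := by simpa using halg 1
    map_mul' := hmul
    map_zero' := by simpa using halg 0
    map_add' := hadd
    commutes' := halg }

theorem desc_inflate (x : ∀ j, FunctionHopf F (D.obj j) →ₐ[F] R)
    (hx : ∀ (i j : J) (f : i ⟶ j) (h : FunctionHopf F (D.obj j)),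
      x i (FunctionHopf.pullback F (ConcreteCategory.hom (D.map f)) h) = x j h)
    (j : J) (h : FunctionHopf F (D.obj j)) : q.desc x hx (q.inflate F j h) = x j h :=
  q.eq_of_inflate_eq (x := fun j h => x j h) hx
    (q.exists_inflate_eq (q.inflate F j h)).choose_spec.choose_spec

end Desc

/-! ### Continuous representations factor through finite quotients -/

/-- Every continuous representation of `G` is inflated from a representation of some finite quotient:
the action `G → End V` is a locally constant function. -/
theorem exists_representation (V : ContRep F G) :
    ∃ (j : J) (σ : Representation F (D.obj j) V.V), ∀ g, σ (q.proj j g) = V.ρ g := by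
  have hc : IsLocallyConstant (V.ρ : G → V.V →ₗ[F] V.V) := by
    refine (IsLocallyConstant.iff_eventually_eq _).2 fun g => ?_
    filter_upwards [Filter.eventually_all.2 fun k => (IsLocallyConstant.iff_eventually_eq _).1
      ((ContRep.continuous_action_iff V.ρ).1 V.continuous_action (Module.finBasis F V.V k)) g]
      with g' hg'
    exact (Module.finBasis F V.V).ext hg'
  obtain ⟨j, σ, hσ⟩ := q.exists_factor ⟨V.ρ, hc⟩
  replace hσ : ∀ g, σ (q.proj j g) = V.ρ g := hσ
  refine ⟨j, { toFun := σ, map_one' := ?_, map_mul' := fun a b => ?_ }, hσ⟩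
  · rw [← map_one (q.proj j), hσ, map_one]
  · obtain ⟨a, rfl⟩ := q.proj_surjective j a
    obtain ⟨b, rfl⟩ := q.proj_surjective j b
    rw [← map_mul, hσ, hσ, hσ, map_mul]

end FiniteQuotientSystem

/-- The matrix coefficient `g ↦ ℓ (g v)` of a representation of a finite group. -/
def Representation.matrixCoeff {F Γ V : Type*} [Field F] [Group Γ] [AddCommGroup V] [Module F V]
    (σ : Representation F Γ V) (ℓ : V →ₗ[F] F) : V →ₗ[F] FunctionHopf F Γ where
  toFun v := fun g => ℓ (σ g v)
  map_add' v w := funext fun g => by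
    rw [map_add, map_add]
    rfl
  map_smul' a v := funext fun g => by
    rw [map_smul, map_smul]
    rfl

namespace FiniteQuotientSystem

attribute [local instance] Fintype.ofFinite

variable {G : Type u} [Group G] [TopologicalSpace G] {J : Type v} [Category J]
  {D : J ⥤ FiniteGrp.{u}} (q : FiniteQuotientSystem G D) {F : Type u} [Field F]
  {R : Type u} [CommRing R] [Algebra F R]

theorem inflate_matrixCoeff {V : ContRep F G} {j : J} {σ : Representation F (D.obj j) V.V}
    (hσ : ∀ g, σ (q.proj j g) = V.ρ g) (ℓ : V.V →ₗ[F] F) (v : V.V) :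
    q.inflate F j (σ.matrixCoeff ℓ v) = V.matrixCoeff ℓ v :=
  LocallyConstant.ext fun g => congr(ℓ ($(hσ g) v))

/-- The point given by evaluation at `1` acts trivially. -/
theorem pointAction_one {x : LocallyConstant G F →ₐ[F] R}
    (hx : ∀ j (h : FunctionHopf F (D.obj j)), x (q.inflate F j h) = algebraMap F R (h 1))
    (V : ContRep F G) : V.pointAction x = LinearMap.id := by
  obtain ⟨j, σ, hσ⟩ := q.exists_representation V
  refine TensorProduct.AlgebraTensorModule.ext fun r v => LinearMap.formBaseChange_ext fun ℓ => ?_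
  rw [ContRep.formBaseChange_pointAction_tmul, ← q.inflate_matrixCoeff hσ, hx,
    LinearMap.id_apply, LinearMap.formBaseChange_tmul]
  exact congr(r * algebraMap F R (ℓ ($(map_one σ) v)))

/-- The convolution product of points, computed on the finite quotients, acts by composition. -/
theorem pointAction_mul {x y z : LocallyConstant G F →ₐ[F] R}
    (hz : ∀ j (h : FunctionHopf F (D.obj j)), z (q.inflate F j h) =
      ∑ a : D.obj j, x (q.inflate F j (FunctionHopf.delta F a)) *
        y (q.inflate F j (FunctionHopf.pullback F (a * ·) h)))
    (V : ContRep F G) : V.pointAction z = V.pointAction x ∘ₗ V.pointAction y := by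
  obtain ⟨j, σ, hσ⟩ := q.exists_representation V
  let b := Module.finBasis F V.V
  refine TensorProduct.AlgebraTensorModule.ext fun r v => LinearMap.formBaseChange_ext fun ℓ => ?_
  -- The matrix coefficients live on `D j`, where `x` is determined by its values on indicators.
  have hx (w : V.V) : x (V.matrixCoeff ℓ w) =
      ∑ a : D.obj j, algebraMap F R (ℓ (σ a w)) * x (q.inflate F j (FunctionHopf.delta F a)) := by
    rw [← q.inflate_matrixCoeff hσ, ← FunctionHopf.sum_smul_delta (σ.matrixCoeff ℓ w)]
    simp only [map_sum, map_smul]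
    simp only [Algebra.smul_def]
    rfl
  -- Matrix multiplication: `ℓ (a c v) = ∑ k, ℓ (a (b k)) * (b k)^* (c v)`.
  have hy (a : D.obj j) : y (q.inflate F j (FunctionHopf.pullback F (a * ·)
      (σ.matrixCoeff ℓ v))) =
        ∑ k, algebraMap F R (ℓ (σ a (b k))) * y (V.matrixCoeff (b.coord k) v) := by
    have h : FunctionHopf.pullback F (a * ·) (σ.matrixCoeff ℓ v) =
        ∑ k, ℓ (σ a (b k)) • σ.matrixCoeff (b.coord k) v := by
      refine funext fun c => .trans ?_ (Finset.sum_apply (M := fun _ : D.obj j => F) c _ _).symm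
      change ℓ (σ (a * c) v) = ∑ k, ℓ (σ a (b k)) * b.repr (σ c v) k
      conv_lhs => rw [map_mul, Module.End.mul_apply, ← b.sum_repr (σ c v),
        map_sum, map_sum]
      exact Finset.sum_congr rfl fun k _ => by rw [map_smul, map_smul, smul_eq_mul, mul_comm]
    rw [h]
    simp only [map_sum, map_smul, q.inflate_matrixCoeff hσ]
    simp only [Algebra.smul_def]
  rw [ContRep.formBaseChange_pointAction_tmul, ← q.inflate_matrixCoeff hσ, hz,
    LinearMap.comp_apply, ContRep.pointAction_tmul _ _ b, map_sum, map_sum]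
  simp only [ContRep.formBaseChange_pointAction_tmul, hx, hy, Finset.mul_sum]
  rw [Finset.sum_comm]
  refine Finset.sum_congr rfl fun k _ => Finset.sum_congr rfl fun a _ => ?_
  ring

end FiniteQuotientSystem

/-! ### Reconstruction of a point from a tensor automorphism -/

instance (F : Type u) [Field F] (Γ : Type v) [Finite Γ] : Module.Finite F (FunctionHopf F Γ) :=
  inferInstanceAs (Module.Finite F (Γ → F))

namespace FiniteQuotientSystem

variable {G : Type u} [Group G] [TopologicalSpace G] {J : Type v} [Category J]
  {D : J ⥤ FiniteGrp.{u}} (q : FiniteQuotientSystem G D) (F : Type u) [Field F]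
  {R : Type u} [CommRing R] [Algebra F R]

/-- The regular representation of a finite quotient of `G` on its algebra of functions, by right
translation of the argument, as a continuous representation of `G`. -/
@[reducible]
def regular (j : J) : ContRep F G where
  V := FunctionHopf F (D.obj j)
  ρ :=
    { toFun := fun g => (FunctionHopf.pullback F (· * q.proj j g)).toLinearMap
      map_one' := LinearMap.ext fun h => funext fun a => congrArg h <|
        show a * q.proj j 1 = a by rw [map_one, mul_one]
      map_mul' := fun g g' => LinearMap.ext fun h => funext fun a => congrArg h <|
        show a * q.proj j (g * g') = a * q.proj j g * q.proj j g' by rw [map_mul, mul_assoc] }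
  continuous_action := (ContRep.continuous_action_iff _).2 fun h =>
    (q.isLocallyConstant_proj j).comp fun b => FunctionHopf.pullback F (· * b) h

variable {F}

/-- Every function on a finite quotient is a matrix coefficient of the regular representation. -/
theorem matrixCoeff_regular (j : J) (h : FunctionHopf F (D.obj j)) :
    (q.regular F j).matrixCoeff (FunctionHopf.counitHom F (D.obj j)).toLinearMap h =
      q.inflate F j h :=
  LocallyConstant.ext fun g => congrArg h (one_mul (q.proj j g))

/-- The matrix coefficients of a representation of a finite quotient are equivariant maps to the
regular representation. -/
def toRegular {V : ContRep F G} {j : J} {σ : Representation F (D.obj j) V.V}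
    (hσ : ∀ g, σ (q.proj j g) = V.ρ g) (ℓ : V.V →ₗ[F] F) : V ⟶ q.regular F j :=
  (σ.matrixCoeff ℓ).intertwiningMap_of_isIntertwiningMap V.ρ (q.regular F j).ρ fun g v =>
    funext fun a => by
      change ℓ (σ a (V.ρ g v)) = ℓ (σ (a * q.proj j g) v)
      rw [map_mul, hσ]
      rfl

/-- The inclusion of the constant functions, as a map of representations. -/
noncomputable def regularUnit (j : J) : ContRep.unit F G ⟶ q.regular F j :=
  (Algebra.linearMap F (FunctionHopf F (D.obj j))).intertwiningMap_of_isIntertwiningMap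
    (ContRep.unit F G).ρ (q.regular F j).ρ fun _ _ => rfl

/-- The pointwise multiplication of functions, as a map of representations. -/
noncomputable def regularMul (j : J) : (q.regular F j).tensor (q.regular F j) ⟶ q.regular F j :=
  (LinearMap.mul' F (FunctionHopf F (D.obj j))).intertwiningMap_of_isIntertwiningMap
    ((q.regular F j).tensor (q.regular F j)).ρ (q.regular F j).ρ fun g t => by
      induction t using TensorProduct.induction_on with
      | zero => simp
      | add s t hs ht => simp only [map_add, hs, ht]
      | tmul h h' => rfl

/-- Pullback of functions along a transition map, as a map of representations. -/
def regularMap {i j : J} (f : i ⟶ j) : q.regular F j ⟶ q.regular F i :=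
  (FunctionHopf.pullback F
    (ConcreteCategory.hom (D.map f))).toLinearMap.intertwiningMap_of_isIntertwiningMap
    (q.regular F j).ρ (q.regular F i).ρ fun g h => funext fun a => congrArg h <| by
      rw [map_mul, q.map_proj]

/-- Evaluation at `1` of functions with values in `R`. -/
noncomputable def evalOne (F : Type u) [Field F] (R : Type u) [CommRing R] [Algebra F R]
    (Γ : Type u) [Group Γ] : R ⊗[F] FunctionHopf F Γ →ₗ[R] R :=
  (FunctionHopf.counitHom F Γ).toLinearMap.formBaseChange R

theorem evalOne_mul {Γ : Type u} [Group Γ] (s t : R ⊗[F] FunctionHopf F Γ) :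
    evalOne F R Γ ((LinearMap.mul' F (FunctionHopf F Γ)).baseChange R
      ((TensorProduct.AlgebraTensorModule.distribBaseChange F R _ _).symm (s ⊗ₜ[R] t))) =
      evalOne F R Γ s * evalOne F R Γ t := by
  induction s with
  | zero => simp
  | add s s' hs hs' => simp only [TensorProduct.add_tmul, map_add, hs, hs', add_mul]
  | tmul r h =>
  induction t with
  | zero => simp
  | add t t' ht ht' => simp only [TensorProduct.tmul_add, map_add, ht, ht', mul_add]
  | tmul r' h' =>
    simp [evalOne]
    ring

/-- The homomorphism `F^{D j} → R` attached to a tensor automorphism `a`: it sends `h` to the value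
at `1` of `a (1 ⊗ h)`, where `h` is an element of the regular representation. -/
noncomputable def finitePoint (a : tensorAut F G R) (j : J) : FunctionHopf F (D.obj j) →ₐ[F] R :=
  AlgHom.ofLinearMap
    ((evalOne F R (D.obj j)).restrictScalars F ∘ₗ
      ((a.1 (q.regular F j)).toLinearMap.restrictScalars F) ∘ₗ
        TensorProduct.mk F R (FunctionHopf F (D.obj j)) 1)
    (by
      have h := a.2.1 _ _ (q.regularUnit (F := F) j) (1 ⊗ₜ 1)
      rw [a.2.2.2] at h
      have h1 : (q.regularUnit (F := F) j).toLinearMap.baseChange R (1 ⊗ₜ 1) = 1 ⊗ₜ 1 := by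
        rw [LinearMap.baseChange_tmul]
        exact congrArg _ (map_one (algebraMap F (FunctionHopf F (D.obj j))))
      rw [h1] at h
      change evalOne F R (D.obj j) (a.1 (q.regular F j) (1 ⊗ₜ 1)) = 1
      rw [← h]
      simp [evalOne])
    (fun h h' => by
      have hm := a.2.1 _ _ (q.regularMul (F := F) j) (1 ⊗ₜ (h ⊗ₜ h'))
      have ht := (LinearEquiv.eq_symm_apply _).2
        (a.2.2.1 (q.regular F j) (q.regular F j) (1 ⊗ₜ (h ⊗ₜ h')))
      rw [ht] at hm
      change evalOne F R (D.obj j) (a.1 (q.regular F j) (1 ⊗ₜ (h * h'))) =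
        evalOne F R (D.obj j) (a.1 (q.regular F j) (1 ⊗ₜ h)) *
          evalOne F R (D.obj j) (a.1 (q.regular F j) (1 ⊗ₜ h'))
      rw [← evalOne_mul]
      exact congrArg _ hm.symm)

theorem finitePoint_apply (a : tensorAut F G R) (j : J) (h : FunctionHopf F (D.obj j)) :
    q.finitePoint a j h = evalOne F R (D.obj j) (a.1 (q.regular F j) (1 ⊗ₜ h)) := rfl

theorem finitePoint_pullback (a : tensorAut F G R) {i j : J} (f : i ⟶ j)
    (h : FunctionHopf F (D.obj j)) :
    q.finitePoint a i (FunctionHopf.pullback F (ConcreteCategory.hom (D.map f)) h) =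
      q.finitePoint a j h := by
  have hf := a.2.1 _ _ (q.regularMap (F := F) f) (1 ⊗ₜ h)
  change evalOne F R (D.obj i) (a.1 (q.regular F i) (1 ⊗ₜ _)) =
    evalOne F R (D.obj j) (a.1 (q.regular F j) (1 ⊗ₜ h))
  refine (congrArg (evalOne F R (D.obj i)) hf).symm.trans ?_
  refine (LinearMap.formBaseChange_baseChange _ _ _).trans ?_
  congr 2
  ext h
  exact congrArg h (map_one (ConcreteCategory.hom (D.map f)))

/-- A point is determined by its action on the regular representations. -/
theorem eq_of_pointAction_eq (q : FiniteQuotientSystem G D) {x y : LocallyConstant G F →ₐ[F] R}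
    (h : ∀ V : ContRep F G, V.pointAction x = V.pointAction y) : x = y := by
  refine q.algHom_ext fun j f => ?_
  have key (z : LocallyConstant G F →ₐ[F] R) := ContRep.formBaseChange_pointAction_tmul
    (q.regular F j) z (FunctionHopf.counitHom F (D.obj j)).toLinearMap 1 f
  simp only [q.matrixCoeff_regular, one_mul] at key
  rw [← key, ← key, h]

variable [IsCofiltered J]

/-- The point of the algebra of locally constant functions attached to a tensor automorphism. -/
noncomputable def point (a : tensorAut F G R) : LocallyConstant G F →ₐ[F] R :=
  q.desc (q.finitePoint a) fun _ _ => q.finitePoint_pullback a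

/-- A tensor automorphism is the action of the point attached to it, because the matrix coefficients
of a representation are equivariant maps to a regular representation. -/
theorem pointAction_point (a : tensorAut F G R) (V : ContRep F G) :
    V.pointAction (q.point a) = (a.1 V).toLinearMap := by
  obtain ⟨j, σ, hσ⟩ := q.exists_representation V
  refine TensorProduct.AlgebraTensorModule.ext fun r v => LinearMap.formBaseChange_ext fun ℓ => ?_
  have h := congrArg (evalOne F R (D.obj j)) (a.2.1 _ _ (q.toRegular hσ ℓ) (1 ⊗ₜ v))
  have hℓ : (FunctionHopf.counitHom F (D.obj j)).toLinearMap ∘ₗ σ.matrixCoeff ℓ = ℓ :=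
    LinearMap.ext fun w => congr(ℓ ($(map_one σ) w))
  have hr : r ⊗ₜ[F] v = r • (1 : R) ⊗ₜ[F] v := by
    rw [TensorProduct.smul_tmul', smul_eq_mul, mul_one]
  rw [ContRep.formBaseChange_pointAction_tmul, ← q.inflate_matrixCoeff hσ, point, desc_inflate,
    finitePoint_apply, hr, map_smul, map_smul, smul_eq_mul]
  congr 1
  refine h.symm.trans ((LinearMap.formBaseChange_baseChange _ _ _).trans ?_)
  exact congr(LinearMap.formBaseChange R $hℓ _)

end FiniteQuotientSystem

/-! ### Uniqueness of the algebraic hull -/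

section Uniqueness

open CartesianMonoidalCategory MonoidalCategory

variable {F : Type u} [Field F]

-- Instance search does not see through the carrier of `CommRingCat.of F`.
instance : (algSpec (CommRingCat.of F)).Full := algSpec.instFull

instance : (algSpec (CommRingCat.of F)).Faithful := algSpec.instFaithful

noncomputable instance : (algSpec (CommRingCat.of F)).Braided := braidedAlgSpec

theorem exists_specOver_iso {X : Over (Spec (CommRingCat.of F))} (hX : IsAffine X.left) :
    ∃ (A : CommAlgCat.{u} F), Nonempty (specOver F A ≅ X) := by
  obtain ⟨A, ⟨e⟩⟩ := essImage_algSpec.2 hX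
  exact ⟨A.unop, ⟨e⟩⟩

theorem exists_specOverMap_eq {R S : Type u} [CommRing R] [Algebra F R] [CommRing S] [Algebra F S]
    (f : specOver F S ⟶ specOver F R) : ∃ φ : R →ₐ[F] S, specOverMap φ = f := by
  obtain ⟨g, rfl⟩ := (algSpec (CommRingCat.of F)).map_surjective f
  exact ⟨g.unop.hom, rfl⟩

/-- Yoneda's lemma for affine group schemes, tested on affine schemes. -/
theorem nonempty_iso_of_natural {H H' : Grp (Over (Spec (CommRingCat.of F)))}
    (hH : IsAffine H.X.left) (hH' : IsAffine H'.X.left)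
    (θ : ∀ (R : Type u) [CommRing R] [Algebra F R],
      (specOver F R ⟶ H.X) ≃* (specOver F R ⟶ H'.X))
    (hθ : ∀ (R S : Type u) [CommRing R] [Algebra F R] [CommRing S] [Algebra F S] (φ : R →ₐ[F] S)
      (x : specOver F R ⟶ H.X), θ S (specOverMap φ ≫ x) = specOverMap φ ≫ θ R x) :
    Nonempty (H ≅ H') := by
  obtain ⟨A, ⟨i⟩⟩ := exists_specOver_iso hH
  obtain ⟨A', ⟨i'⟩⟩ := exists_specOver_iso hH'
  let f : H.X ⟶ H'.X := i.inv ≫ θ A i.hom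
  let f' : H'.X ⟶ H.X := i'.inv ≫ (θ A').symm i'.hom
  have hf (R : Type u) [CommRing R] [Algebra F R] (x : specOver F R ⟶ H.X) : x ≫ f = θ R x := by
    obtain ⟨φ, hφ⟩ := exists_specOverMap_eq (x ≫ i.inv)
    have : x = specOverMap φ ≫ i.hom := by simp [hφ]
    rw [this, hθ]
    simp [f]
  have hf' (R : Type u) [CommRing R] [Algebra F R] (x : specOver F R ⟶ H'.X) :
      x ≫ f' = (θ R).symm x := by
    obtain ⟨φ, hφ⟩ := exists_specOverMap_eq (x ≫ i'.inv)
    have : x = specOverMap φ ≫ i'.hom := by simp [hφ]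
    rw [this, MulEquiv.eq_symm_apply, ← hf, Category.assoc]
    simp only [f', Iso.hom_inv_id_assoc, Category.assoc]
    rw [hf, MulEquiv.apply_symm_apply]
  have hff' : f ≫ f' = 𝟙 _ := by
    rw [← cancel_epi i.hom, ← Category.assoc, hf, hf', MulEquiv.symm_apply_apply, Category.comp_id]
  have hf'f : f' ≫ f = 𝟙 _ := by
    rw [← cancel_epi i'.hom, ← Category.assoc, hf', hf, MulEquiv.apply_symm_apply,
      Category.comp_id]
  have hmul {T : Over (Spec (CommRingCat.of F))} (B : CommAlgCat.{u} F) (j : specOver F B ≅ T)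
      (x y : T ⟶ H.X) : (x * y) ≫ f = x ≫ f * y ≫ f := by
    rw [← cancel_epi j.hom, MonObj.comp_mul, ← Category.assoc, MonObj.comp_mul, hf, map_mul,
      ← hf, ← hf, Category.assoc, Category.assoc]
  -- `H`, `H × H` and the terminal object are affine, so it suffices to test `f` on affine points.
  have : IsMonHom f :=
    { mul_hom := by
        rw [MonObj.mul_eq_mul, hmul (.of F (A ⊗[F] A))
          ((Functor.Monoidal.μIso (algSpec (CommRingCat.of F)) (.op A) (.op A)).symm ≪≫
            (i ⊗ᵢ i))]
        rw [MonObj.mul_eq_mul, MonObj.comp_mul]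
        simp
      one_hom := by
        have h1 := hmul (.of F F) (Functor.Monoidal.εIso (algSpec (CommRingCat.of F))).symm 1 1
        rw [mul_one, left_eq_mul] at h1
        rwa [MonObj.one_eq_one, MonObj.one_eq_one] }
  exact ⟨Grp.mkIso' ⟨f, f', hff', hf'f⟩⟩

variable {G : Type v} [Group G] [TopologicalSpace G]

/-- Algebraic hulls are unique up to isomorphism. -/
theorem IsAlgebraicHull.nonempty_iso {H H' : Grp (Over (Spec (CommRingCat.of F)))}
    (h : IsAlgebraicHull F G H) (h' : IsAlgebraicHull F G H') : Nonempty (H ≅ H') := by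
  obtain ⟨hH, e, he⟩ := h
  obtain ⟨hH', e', he'⟩ := h'
  refine nonempty_iso_of_natural hH hH' (fun R _ _ => (e R).trans (e' R).symm) ?_
  intro R S _ _ _ _ φ x
  rw [MulEquiv.trans_apply, MulEquiv.symm_apply_eq]
  refine Subtype.ext (funext fun V => LinearEquiv.toLinearMap_injective ?_)
  -- An `S`-linear map on `S ⊗ V` is determined by its values on the image of `R ⊗ V`.
  refine TensorProduct.AlgebraTensorModule.ext fun s v => ?_
  have hs : s ⊗ₜ[F] v = s • φ.toLinearMap.rTensor V.V (1 ⊗ₜ v) := by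
    simp [TensorProduct.smul_tmul']
  rw [hs, map_smul, map_smul]
  congr 1
  refine (he R S φ x V _).trans (.trans ?_ (he' R S φ _ V _).symm)
  rw [MulEquiv.trans_apply, MulEquiv.apply_symm_apply]

end Uniqueness

/-! ### Points of affine schemes and of constant group schemes -/

section Points

variable {F : Type u} [Field F] {A R S : Type u} [CommRing A] [Algebra F A] [CommRing R]
  [Algebra F R] [CommRing S] [Algebra F S]

/-- The algebra homomorphism corresponding to a morphism of affine schemes. -/
noncomputable def algHomOfPoint (x : specOver F R ⟶ specOver F A) : A →ₐ[F] R :=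
  ((algSpec (CommRingCat.of F)).preimage x).unop.hom

theorem specOverMap_algHomOfPoint (x : specOver F R ⟶ specOver F A) :
    specOverMap (algHomOfPoint x) = x :=
  (algSpec (CommRingCat.of F)).map_preimage x

theorem algHomOfPoint_specOverMap (φ : A →ₐ[F] R) : algHomOfPoint (specOverMap φ) = φ :=
  congr(($((algSpec (CommRingCat.of F)).preimage_map (CommAlgCat.ofHom φ).op)).unop.hom)

theorem specOverMap_comp (φ : A →ₐ[F] R) (ψ : R →ₐ[F] S) :
    specOverMap (ψ.comp φ) = specOverMap ψ ≫ specOverMap φ :=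
  (algSpec (CommRingCat.of F)).map_comp (CommAlgCat.ofHom ψ).op (CommAlgCat.ofHom φ).op

theorem algHomOfPoint_comp (φ : R →ₐ[F] S) (x : specOver F R ⟶ specOver F A) :
    algHomOfPoint (specOverMap φ ≫ x) = φ.comp (algHomOfPoint x) := by
  conv_lhs => rw [← specOverMap_algHomOfPoint x, ← specOverMap_comp, algHomOfPoint_specOverMap]

variable (Γ : FiniteGrp.{u})

/-- The point of the constant group scheme of `Γ` given by a homomorphism from the algebra of
functions on `Γ`. -/
noncomputable def constantPoint (φ : FunctionHopf F Γ →ₐ[F] R) :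
    specOver F R ⟶ ((constantGroupScheme F).obj Γ).X :=
  specOverMap φ

theorem constantPoint_injective : Function.Injective (constantPoint (F := F) (R := R) Γ) :=
  Function.LeftInverse.injective (g := algHomOfPoint) algHomOfPoint_specOverMap

/-- The group law on points of a constant group scheme is convolution. -/
theorem constantPoint_mul (φ ψ : FunctionHopf F Γ →ₐ[F] R) :
    constantPoint Γ φ * constantPoint Γ ψ =
      constantPoint Γ ((Algebra.TensorProduct.lift φ ψ (fun _ _ => Commute.all _ _)).comp
        (FunctionHopf.comulHom F Γ)) := by
  have h : constantPoint Γ φ * constantPoint Γ ψ = (algSpec (CommRingCat.of F)).map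
      ((CommAlgCat.ofHom φ).op * (CommAlgCat.ofHom ψ).op) := by
    rw [Functor.map_mul]
    rfl
  exact h

theorem constantPoint_one :
    constantPoint Γ ((Algebra.ofId F R).comp (FunctionHopf.counitHom F Γ)) = 1 := by
  have h : (1 : specOver F R ⟶ ((constantGroupScheme F).obj Γ).X) =
      (algSpec (CommRingCat.of F)).map (1 : Opposite.op (CommAlgCat.of F R) ⟶
        .op (.of F (FunctionHopf F Γ))) := by
    rw [Functor.map_one]
    rfl
  exact h.symm

end Points

namespace FiniteQuotientSystem

variable {G : Type u} [Group G] [TopologicalSpace G] {J : Type u} [SmallCategory J]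
  [IsCofiltered J] {D : J ⥤ FiniteGrp.{u}} (q : FiniteQuotientSystem G D) (F : Type u) [Field F]

/-! ### The limit of the constant group schemes -/

/-- The diagram of the algebras of functions on the finite groups `D j`, in the opposite of the
category of commutative algebras. -/
noncomputable def functionAlgebras (D : J ⥤ FiniteGrp.{u}) (F : Type u) [Field F] :
    J ⥤ (CommAlgCat.{u} F)ᵒᵖ where
  obj j := .op (.of F (FunctionHopf F (D.obj j)))
  map f := (CommAlgCat.ofHom (FunctionHopf.pullback F (ConcreteCategory.hom (D.map f)))).op
  map_id j := by
    rw [D.map_id]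
    rfl
  map_comp f g := by
    rw [D.map_comp]
    rfl

/-- The algebra of locally constant functions on `G` as a cocone under the function algebras of
the finite quotients, that is, a cone in the opposite category. -/
noncomputable def algebraCone : Cone (functionAlgebras D F) where
  pt := .op (.of F (LocallyConstant G F))
  π :=
    { app := fun j => (CommAlgCat.ofHom (q.inflate F j)).op
      naturality := fun _ _ f => Quiver.Hom.unop_inj <| CommAlgCat.hom_ext <| AlgHom.ext fun h =>
        (q.inflate_pullback f h).symm }

/-- The algebra of locally constant functions is the colimit of the function algebras of the finite
quotients. -/
noncomputable def isLimitAlgebraCone : IsLimit (q.algebraCone F) :=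
  let x (s : Cone (functionAlgebras D F)) (j : J) : FunctionHopf F (D.obj j) →ₐ[F] s.pt.unop :=
    (s.π.app j).unop.hom
  have hx (s : Cone (functionAlgebras D F)) (i j : J) (f : i ⟶ j) (h : FunctionHopf F (D.obj j)) :
      x s i (FunctionHopf.pullback F (ConcreteCategory.hom (D.map f)) h) = x s j h := by
    have hf := congrArg (fun g => g.unop.hom) (s.w f)
    exact congr($hf h)
  { lift := fun s => (CommAlgCat.ofHom (q.desc (x s) (hx s))).op
    fac := fun s j => Quiver.Hom.unop_inj <| CommAlgCat.hom_ext <| AlgHom.ext fun h =>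
      q.desc_inflate (x s) (hx s) j h
    uniq := fun s m w => Quiver.Hom.unop_inj <| CommAlgCat.hom_ext <| q.algHom_ext fun j h => by
      have hj := congrArg (fun g => g.unop.hom) (w j)
      exact congr($hj h).trans (q.desc_inflate (x s) (hx s) j h).symm }

/-- The spectrum of the algebra of locally constant functions, as a cone over the schemes underlying
the constant group schemes of the finite quotients. -/
noncomputable def schemeCone : Cone ((D ⋙ constantGroupScheme F) ⋙ Grp.forget _) where
  pt := specOver F (LocallyConstant G F)
  π :=
    { app := fun j => specOverMap (q.inflate F j)
      naturality := fun _ _ f =>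
        ((algSpec (CommRingCat.of F)).mapCone (q.algebraCone F)).π.naturality f }

/-- The spectrum of the algebra of locally constant functions is the limit of the underlying schemes
of the constant group schemes, since `Spec` turns colimits of algebras into limits. -/
noncomputable def isLimitSchemeCone : IsLimit (q.schemeCone F) :=
  have : PreservesLimitsOfSize.{u, u} (algSpec (CommRingCat.of F)) := preservesLimitsOfSize_algSpec
  let h := isLimitOfPreserves (algSpec (CommRingCat.of F)) (q.isLimitAlgebraCone F)
  -- The two diagrams of schemes agree definitionally, object by object and map by map.
  let t (s : Cone ((D ⋙ constantGroupScheme F) ⋙ Grp.forget _)) :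
      Cone (functionAlgebras D F ⋙ algSpec (CommRingCat.of F)) :=
    { pt := s.pt
      π :=
        { app := fun j => s.π.app j
          naturality := fun _ _ f => s.π.naturality f } }
  { lift := fun s => h.lift (t s)
    fac := fun s j => h.fac (t s) j
    uniq := fun s m w => h.uniq (t s) m w }

/-- The limit of the constant group schemes of the finite quotients of `G`. Its underlying scheme is
the spectrum of the algebra of locally constant functions on `G`. -/
noncomputable def limitGroupScheme : LimitCone (D ⋙ constantGroupScheme F) where
  cone := Grp.limitCone _ (q.schemeCone F) (q.isLimitSchemeCone F)
  isLimit := Grp.isLimitLimitCone _ (q.schemeCone F) (q.isLimitSchemeCone F)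

end FiniteQuotientSystem

namespace FiniteQuotientSystem

variable {G : Type u} [Group G] [TopologicalSpace G] {J : Type u} [SmallCategory J]
  [IsCofiltered J] {D : J ⥤ FiniteGrp.{u}} (q : FiniteQuotientSystem G D) {F : Type u} [Field F]
  {R S : Type u} [CommRing R] [Algebra F R] [CommRing S] [Algebra F S]

attribute [local instance] Fintype.ofFinite

/-! ### The limit group scheme is the algebraic hull -/

/-- The homomorphism from the algebra of locally constant functions to `R` corresponding to an
`R`-point of the limit group scheme. -/
noncomputable def limitPoint (x : specOver F R ⟶ (q.limitGroupScheme F).cone.pt.X) :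
    LocallyConstant G F →ₐ[F] R :=
  algHomOfPoint x

theorem limitPoint_bijective :
    Function.Bijective (q.limitPoint (F := F) (R := R)) :=
  ⟨Function.LeftInverse.injective (g := specOverMap) specOverMap_algHomOfPoint,
    Function.RightInverse.surjective (g := specOverMap) algHomOfPoint_specOverMap⟩

theorem limitPoint_comp (φ : R →ₐ[F] S) (x : specOver F R ⟶ (q.limitGroupScheme F).cone.pt.X) :
    q.limitPoint (specOverMap φ ≫ x) = φ.comp (q.limitPoint x) :=
  algHomOfPoint_comp φ _

theorem comp_proj_eq_constantPoint (x : specOver F R ⟶ (q.limitGroupScheme F).cone.pt.X) (j : J) :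
    x ≫ ((q.limitGroupScheme F).cone.π.app j).hom.hom =
      constantPoint (D.obj j) ((q.limitPoint x).comp (q.inflate F j)) := by
  have h : constantPoint (D.obj j) ((q.limitPoint x).comp (q.inflate F j)) =
      specOverMap (q.limitPoint x) ≫ specOverMap (q.inflate F j) := specOverMap_comp _ _
  exact .trans congr($((specOverMap_algHomOfPoint x).symm) ≫ specOverMap (q.inflate F j)) h.symm

theorem limitPoint_mul (x y : specOver F R ⟶ (q.limitGroupScheme F).cone.pt.X) (j : J)
    (h : FunctionHopf F (D.obj j)) :
    q.limitPoint (x * y) (q.inflate F j h) =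
      ∑ a : D.obj j, q.limitPoint x (q.inflate F j (FunctionHopf.delta F a)) *
        q.limitPoint y (q.inflate F j (FunctionHopf.pullback F (a * ·) h)) := by
  have hj := MonObj.mul_comp x y ((q.limitGroupScheme F).cone.π.app j).hom.hom
  simp only [comp_proj_eq_constantPoint] at hj
  have hj := constantPoint_injective _ (hj.trans (constantPoint_mul _ _ _))
  refine congr($hj h).trans ?_
  rw [AlgHom.comp_apply, FunctionHopf.comulHom_apply, map_sum]
  rfl

theorem limitPoint_one (j : J) (h : FunctionHopf F (D.obj j)) :
    q.limitPoint (1 : specOver F R ⟶ (q.limitGroupScheme F).cone.pt.X) (q.inflate F j h) =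
      algebraMap F R (h 1) := by
  have hj := MonObj.one_comp (X := specOver F R) ((q.limitGroupScheme F).cone.π.app j).hom.hom
  rw [comp_proj_eq_constantPoint] at hj
  have hj := constantPoint_injective _ (hj.trans (constantPoint_one _).symm)
  exact congr($hj h)

theorem pointAction_limitPoint_mul (x y : specOver F R ⟶ (q.limitGroupScheme F).cone.pt.X)
    (V : ContRep F G) :
    V.pointAction (q.limitPoint (x * y)) =
      V.pointAction (q.limitPoint x) ∘ₗ V.pointAction (q.limitPoint y) :=
  q.pointAction_mul (q.limitPoint_mul x y) V

theorem pointAction_limitPoint_of_mul_eq_one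
    {x y : specOver F R ⟶ (q.limitGroupScheme F).cone.pt.X} (h : x * y = 1) (V : ContRep F G) :
    V.pointAction (q.limitPoint x) ∘ₗ V.pointAction (q.limitPoint y) = LinearMap.id := by
  rw [← pointAction_limitPoint_mul, h]
  exact q.pointAction_one q.limitPoint_one V

/-- The action of the points of the limit group scheme on representations, as a homomorphism to
the group of tensor automorphisms. -/
noncomputable def limitAction (F R : Type u) [Field F] [CommRing R] [Algebra F R] :
    (specOver F R ⟶ (q.limitGroupScheme F).cone.pt.X) →* tensorAut F G R :=
  .mk' (fun x => ⟨fun V => LinearEquiv.ofLinearMap (V.pointAction (q.limitPoint x))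
      (V.pointAction (q.limitPoint x⁻¹))
      (q.pointAction_limitPoint_of_mul_eq_one (mul_inv_cancel x) V)
      (q.pointAction_limitPoint_of_mul_eq_one (inv_mul_cancel x) V),
    fun _ _ f t => ContRep.pointAction_natural f _ t,
    fun V W t => ContRep.pointAction_tensor V W _ t,
    fun t => ContRep.pointAction_unit _ t⟩)
    fun x y => Subtype.ext <| funext fun V => LinearEquiv.toLinearMap_injective <|
      q.pointAction_limitPoint_mul x y V

theorem limitAction_apply (x : specOver F R ⟶ (q.limitGroupScheme F).cone.pt.X)
    (V : ContRep F G) (t : R ⊗[F] V.V) :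
    (q.limitAction F R x).1 V t = V.pointAction (q.limitPoint x) t := rfl

theorem limitAction_bijective (F R : Type u) [Field F] [CommRing R] [Algebra F R] :
    Function.Bijective (q.limitAction F R) := by
  refine ⟨fun x y h => q.limitPoint_bijective.1 (q.eq_of_pointAction_eq fun V => ?_), fun a => ?_⟩
  · exact LinearMap.ext fun t => congr(($h).1 V t)
  · obtain ⟨x, hx⟩ := q.limitPoint_bijective.2 (q.point a)
    refine ⟨x, Subtype.ext <| funext fun V => LinearEquiv.toLinearMap_injective ?_⟩
    refine .trans ?_ (q.pointAction_point a V)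
    rw [← hx]
    rfl

theorem isAlgebraicHull_limitGroupScheme (F : Type u) [Field F] :
    IsAlgebraicHull F G (q.limitGroupScheme F).cone.pt := by
  refine ⟨?_, fun R _ _ => .ofBijective (q.limitAction F R) (q.limitAction_bijective F R), ?_⟩
  · exact essImage_algSpec.1 ((algSpec (CommRingCat.of F)).obj_mem_essImage
      (.op (.of F (LocallyConstant G F))))
  · intro R S _ _ _ _ φ x V t
    rw [MulEquiv.ofBijective_apply, MulEquiv.ofBijective_apply, limitAction_apply,
      limitAction_apply, limitPoint_comp, ContRep.pointAction_comp]

end FiniteQuotientSystem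

/-! ### The presentation of a limit of finite groups -/

section Presentation

variable {J : Type u} [SmallCategory J] [IsCofiltered J] {D : J ⥤ FiniteGrp.{u}}

/-- The projections of a cofiltered limit of finite groups with surjective transition maps are
surjective. -/
theorem ProfiniteGrp.proj_surjective
    (hD : ∀ (i j : J) (f : i ⟶ j), Function.Surjective (ConcreteCategory.hom (D.map f)))
    {c : Cone (D ⋙ forget₂ FiniteGrp.{u} ProfiniteGrp.{u})} (hc : IsLimit c) (j : J) :
    Function.Surjective (c.π.app j).hom := by
  intro a
  have (j : J) : Finite ((D ⋙ forget FiniteGrp.{u}).obj j) := (D.obj j).isFinite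
  have (j : J) : Nonempty ((D ⋙ forget FiniteGrp.{u}).obj j) := ⟨(1 : D.obj j)⟩
  obtain ⟨s, hs⟩ := (D ⋙ forget FiniteGrp.{u}).eval_section_surjective_of_surjective
    (fun i j f => hD i j f) j a
  let c' := ProfiniteGrp.limitCone (D ⋙ forget₂ FiniteGrp.{u} ProfiniteGrp.{u})
  let t : c'.pt := ⟨s.1, fun f => s.2 f⟩
  exact ⟨(hc.lift c').hom t, congr(($(hc.fac c' j)).hom t).trans hs⟩

/-- A limit of finite groups with surjective transition maps, with its projections, as a system of
finite quotients. -/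
noncomputable def finiteQuotientSystemOfIsLimit
    (hD : ∀ (i j : J) (f : i ⟶ j), Function.Surjective (ConcreteCategory.hom (D.map f)))
    (c : Cone (D ⋙ forget₂ FiniteGrp.{u} ProfiniteGrp.{u})) (hc : IsLimit c) :
    FiniteQuotientSystem c.pt D where
  proj j := (c.π.app j).hom.toMonoidHom
  map_proj f g := congr($(c.w f).hom g)
  proj_surjective := ProfiniteGrp.proj_surjective hD hc
  -- The topology of a finite group, seen as a profinite group, is `⊥`.
  isLocallyConstant_proj j := fun s =>
    IsOpen.preimage (c.π.app j).hom.continuous_toFun (show @IsOpen _ ⊥ s from trivial)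
  exists_factor f := by
    obtain ⟨j, f', hf'⟩ := Profinite.exists_locallyConstant _
      (isLimitOfPreserves (forget₂ ProfiniteGrp.{u} Profinite.{u}) hc) f
    exact ⟨j, f', fun g => congr($hf' g).symm⟩

end Presentation

theorem lemma2p4 (F : Type u) [Field F] {J : Type u} [SmallCategory J] [IsCofiltered J]
    (D : J ⥤ FiniteGrp.{u})
    (hD : ∀ (i j : J) (f : i ⟶ j), Function.Surjective (ConcreteCategory.hom (D.map f)))
    (c : Cone (D ⋙ forget₂ FiniteGrp.{u} ProfiniteGrp.{u})) (hc : IsLimit c) :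
    ∃ L : LimitCone (D ⋙ constantGroupScheme F),
      (∃ H : Grp (Over (Spec (CommRingCat.of F))), IsAlgebraicHull F c.pt H) ∧
      ∀ H : Grp (Over (Spec (CommRingCat.of F))), IsAlgebraicHull F c.pt H →
        Nonempty (H ≅ L.cone.pt) := by
  let q := finiteQuotientSystemOfIsLimit hD c hc
  have h := q.isAlgebraicHull_limitGroupScheme F
  exact ⟨q.limitGroupScheme F, ⟨_, h⟩, fun H hH => hH.nonempty_iso h⟩
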